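/- **Theorem 3.2.** Let $r \ge 2$ be a fixed integer. Let $H(n,r,1/2)$ be the random $r$-uniform hypergraph on the vertex set $[n]$ in which each $r$-element subset of $[n]$ is an edge independently with probability $1/2$. *Triangles.* A triangle of a hypergraph $H=(V,E)$ is a closed path $v_0,e_0,v_1,e_1,v_2,e_2$ with $v_i\in V$, $e_i\in E$ and $v_i\in e_{i-1}\cap e_i$ (indices modulo $3$), considered up to the choice of the starting vertex and of the direction of traversal. It is *simple* if $v_0,v_1,v_2$ are distinct and $e_0,e_1,e_2$ are distinct, and *induced* if it is simple and $v_i\notin e_{i+1}$ for all $i$. In the triangle listing problem each vertex $v$ outputs a set $\mathcal T_v$ of triangles of $H$ such that $\bigcup_v\mathcal T_v$ is the set of all triangles of $H$; there are three variants, according to whether all, only the simple, or only the induced triangles are meant. *Models.* The vertices of $H$ are computing entities. Initially each vertex knows $n$, its own identifier in $[n]$, and its incident edges (as sets of identifiers). Computation proceeds in synchronous rounds; local computation is unrestricted and may be randomized (private or shared random bits, independent of $H$) or deterministic. In each round of the CLIQUE model each vertex can send a message of at most $B$ bits to every other vertex, with possibly different messages for different recipients; in the PRIMAL CONGEST model it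 can do so only for the vertices with which it shares an edge. Here $B=O(\log n)$. Each vertex terminates at some time, with an output; the number of rounds of an execution is the time at which the last vertex terminates. Then there is a constant $p<1$, depending only on $r$, such that for every constant $C$ there is $c>0$, depending only on $r$ and $C$, with the following property for all sufficiently large $n$ (depending on $r$ and $C$) and all $B\le C\log n$: every randomized or deterministic algorithm in the CLIQUE model which, on input $H\sim H(n,r,1/2)$, solves triangle listing (in any of the three variants) with probability at least $p$ over $H$ and the algorithm's random choices uses at least $$c\,\frac{n^{r-5/3}}{\log n}$$ rounds in expectation (and hence in the worst case). The same holds for algorithms in the PRIMAL CONGEST model. -/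

import Mathlib

open MeasureTheory ProbabilityTheory Filter
open scoped ENNReal

noncomputable section

namespace HypergraphTriangles

/-! ### Random uniform hypergraphs -/

/-- The hypergraph on the vertex set `Fin n` with a given set of edges. -/
def ofEdges {n : ℕ} (E : Set (Set (Fin n))) : Hypergraph (Fin n) where
  vertexSet := Set.univ
  edgeSet := E
  subset_vertexSet_of_mem_edgeSet' := fun _ _ => Set.subset_univ _

/-- There are finitely many hypergraphs on `Fin n`; every set of them is an event. -/
instance instMeasurableSpaceHypergraph (n : ℕ) : MeasurableSpace (Hypergraph (Fin n)) := ⊤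

/-- `H(n, r, p)`: every `r`-element subset of the vertex set `Fin n` is an edge with probability
`p`, independently of the others, and there are no other edges. -/
def randomHypergraph (n r : ℕ) (p : unitInterval) : Measure (Hypergraph (Fin n)) :=
  (setBernoulli {e : Set (Fin n) | e.ncard = r} p).map ofEdges

instance instIsProbabilityMeasureRandomHypergraph (n r : ℕ) (p : unitInterval) :
    IsProbabilityMeasure (randomHypergraph n r p) :=
  Measure.isProbabilityMeasure_map (Measurable.of_discrete).aemeasurable

/-- The probability `1 / 2`. -/
def half : unitInterval := ⟨1 / 2, by norm_num, by norm_num⟩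

/-! ### Triangles -/

/-- The data `(v₀, e₀, v₁, e₁, v₂, e₂)` of a (potential) triangle; indices are modulo `3`. -/
structure Triple (n : ℕ) where
  /-- the vertices -/
  v : Fin 3 → Fin n
  /-- the edges -/
  e : Fin 3 → Set (Fin n)

/-- The three usual variants of the notion of a triangle. -/
inductive TriangleKind
  /-- all closed paths of length three -/
  | closedPath
  /-- closed paths of length three with distinct vertices and distinct edges -/
  | simple
  /-- simple triangles in which no vertex lies on the opposite edge (open triangles) -/
  | induced

/-- `T` is a closed path of length three in `H`. -/
def Triple.IsClosedPath {n : ℕ} (H : Hypergraph (Fin n)) (T : Triple n) : Prop :=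
  ∀ i, T.e i ∈ H.edgeSet ∧ T.v i ∈ T.e (i - 1) ∧ T.v i ∈ T.e i

/-- The vertices of `T` are pairwise distinct, and so are its edges. -/
def Triple.IsSimple {n : ℕ} (T : Triple n) : Prop :=
  Function.Injective T.v ∧ Function.Injective T.e

/-- `T` is a triangle of `H` of the given kind. -/
def IsTriangle {n : ℕ} (H : Hypergraph (Fin n)) (T : Triple n) : TriangleKind → Prop
  | .closedPath => T.IsClosedPath H
  | .simple => T.IsClosedPath H ∧ T.IsSimple
  | .induced => T.IsClosedPath H ∧ T.IsSimple ∧ ∀ i, T.v i ∉ T.e (i + 1)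

/-- `T` and `T'` describe the same cyclic sequence, up to the choice of the starting vertex and of
the direction of traversal. -/
def Triple.Same {n : ℕ} (T T' : Triple n) : Prop :=
  (∃ k, ∀ i, T'.v i = T.v (k + i) ∧ T'.e i = T.e (k + i)) ∨
    (∃ k, ∀ i, T'.v i = T.v (k - i) ∧ T'.e i = T.e (k - i - 1))

/-- The local outputs `S v` solve triangle listing on `H`: only triangles of `H` are listed, and
every triangle of `H` is listed (in at least one of its representations) by some vertex. -/
def ListsTriangles {n : ℕ} (K : TriangleKind) (H : Hypergraph (Fin n))
    (S : Fin n → Set (Triple n)) : Prop :=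
  (∀ v, ∀ T ∈ S v, IsTriangle H T K) ∧
    ∀ T, IsTriangle H T K → ∃ v, ∃ T' ∈ S v, T.Same T'

/-! ### Synchronous distributed algorithms -/

/-- The two communication models. -/
inductive Model
  /-- CLIQUE: in each round every vertex can send a message to every other vertex -/
  | clique
  /-- PRIMAL CONGEST: in each round every vertex can send a message to every vertex with which it
  shares an edge -/
  | primalCongest

/-- In the model, `u` can send a message to `v` when the network is `H`. -/
def Model.CanSend {n : ℕ} (H : Hypergraph (Fin n)) (u v : Fin n) : Model → Prop
  | .clique => u ≠ v
  | .primalCongest => u ≠ v ∧ H.Adj u v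

/-- Messages: strings of at most `B` bits. The empty string also stands for silence. -/
def Message (B : ℕ) : Type := {l : List Bool // l.length ≤ B}

/-- The empty message. -/
def Message.silence {B : ℕ} : Message B := ⟨[], Nat.zero_le B⟩

/-- What a vertex has received so far: for each past round, the message from each vertex. -/
abbrev History (n B : ℕ) : Type := List (Fin n → Message B)

/-- The initial knowledge of `v` about the network (`KT₁`): its incident edges, each given as a set
of vertex identifiers. -/
def incidentEdges {n : ℕ} (H : Hypergraph (Fin n)) (v : Fin n) : Set (Set (Fin n)) :=
  {e | e ∈ H.edgeSet ∧ v ∈ e}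

/-- A distributed algorithm for networks on the `n` vertices `Fin n` with messages of at most `B`
bits. Its random choices are a function of a point `ω` of a probability space `Ω`. All vertices may
use all of `ω`, so that shared randomness is allowed; private randomness is the case in which `Ω` is
a product and a vertex uses only its own coordinate, and deterministic algorithms are those that
ignore `ω`. The local computations are unrestricted. -/
structure Algorithm (n B : ℕ) (Ω : Type*) [MeasurableSpace Ω] where
  /-- `send u v ω I h` is the message that `u` addresses to `v` in the next round, where `I` is the
  set of edges incident to `u` and `h` is what `u` has received so far. -/
  send : Fin n → Fin n → Ω → Set (Set (Fin n)) → History n B → Message B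
  /-- `decide v ω I h` is the output of `v` if `v` terminates when its incident edges are `I` and it
  has received `h`, and `none` if `v` goes on. -/
  decide : Fin n → Ω → Set (Set (Fin n)) → History n B → Option (Set (Triple n))
  measurable_send : ∀ u v I h m, MeasurableSet {ω | send u v ω I h = m}
  measurable_decide : ∀ v I h o, MeasurableSet {ω | decide v ω I h = o}

namespace Algorithm

variable {n B : ℕ} {Ω : Type*} [MeasurableSpace Ω]

open Classical in
/-- `A.history M H ω t v` is what `v` has received in the first `t` rounds of the execution. -/
def history (A : Algorithm n B Ω) (M : Model) (H : Hypergraph (Fin n)) (ω : Ω) :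
    ℕ → Fin n → History n B
  | 0, _ => []
  | t + 1, v => A.history M H ω t v ++ [fun u =>
      if M.CanSend H u v then A.send u v ω (incidentEdges H u) (A.history M H ω t u)
      else Message.silence]

/-- The decision of `v` after `t` rounds. -/
def decision (A : Algorithm n B Ω) (M : Model) (H : Hypergraph (Fin n)) (ω : Ω) (t : ℕ)
    (v : Fin n) : Option (Set (Triple n)) :=
  A.decide v ω (incidentEdges H v) (A.history M H ω t v)

/-- `v` terminates after exactly `t` rounds, with output `S`. (Its output is then final. It may keep
answering messages, which only helps the algorithm.) -/
def TerminatesWith (A : Algorithm n B Ω) (M : Model) (H : Hypergraph (Fin n)) (ω : Ω) (v : Fin n)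
    (t : ℕ) (S : Set (Triple n)) : Prop :=
  A.decision M H ω t v = some S ∧ ∀ s < t, A.decision M H ω s v = none

/-- The number of rounds of the execution: the first time by which all vertices have terminated,
and `⊤` if some vertex never does. -/
def rounds (A : Algorithm n B Ω) (M : Model) (H : Hypergraph (Fin n)) (ω : Ω) : ℕ∞ :=
  ⨆ v : Fin n, sInf {τ : ℕ∞ | ∃ (t : ℕ) (S : Set (Triple n)),
    A.TerminatesWith M H ω v t S ∧ τ = (t : ℕ∞)}

/-- In the execution all vertices terminate and their outputs solve triangle listing. -/
def Succeeds (A : Algorithm n B Ω) (M : Model) (K : TriangleKind) (H : Hypergraph (Fin n))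
    (ω : Ω) : Prop :=
  ∃ S : Fin n → Set (Triple n),
    (∀ v, ∃ t, A.TerminatesWith M H ω v t (S v)) ∧ ListsTriangles K H S

/-- The probability that the algorithm solves triangle listing when the network is drawn from `D`
and, independently, the random choices are drawn from `P`. -/
def successProbability (A : Algorithm n B Ω) (M : Model) (K : TriangleKind)
    (D : Measure (Hypergraph (Fin n))) (P : Measure Ω) : ℝ≥0∞ :=
  (D.prod P) {x | A.Succeeds M K x.1 x.2}

/-- The expected number of rounds when the network is drawn from `D` and, independently, the random
choices are drawn from `P`. -/
def expectedRounds (A : Algorithm n B Ω) (M : Model)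
    (D : Measure (Hypergraph (Fin n))) (P : Measure Ω) : ℝ≥0∞ :=
  ∫⁻ x, ((A.rounds M x.1 x.2 : ℕ∞) : ℝ≥0∞) ∂(D.prod P)

end Algorithm

end HypergraphTriangles

end

/-!
If every vertex terminates within `T` rounds, the output of each is a function of its transcript,
the pair of its incident edges and the messages it has received, and this transcript takes at most
`2 ^ n ^ (r - 1) * 3 ^ (B n T)` values. With probability bounded below, the random hypergraph has
a constant fraction of all `n ^ (3 (r - 1))` potential loose triangles, which are triangles of all
three kinds, so some vertex lists at least a fraction `1 / n` of them. By the Cauchy–Schwarz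
inequality `m` edges span only `O((n ^ (r - 2) m) ^ (3 / 2))` loose triangles, hence the output of
that vertex names `m ≥ γ n ^ (r - 2 / 3)` edges, all of them present. A set of `m` edges fixed in
advance is present with probability at most `p ^ m`, so by the union bound over transcripts such an
output is likely only if `B n T` is of order `n ^ (r - 2 / 3)`.
-/

namespace HypergraphTriangles

/-! ### Loose triangles spanned by a set of edges -/

lemma sq_sum_mul_mul_le {α β γ R : Type*} [Fintype α] [Fintype β] [Fintype γ] [CommSemiring R]
    [LinearOrder R] [IsStrictOrderedRing R] [ExistsAddOfLE R]
    (f : α → β → R) (g : β → γ → R) (h : γ → α → R) :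
    (∑ x, ∑ y, ∑ z, f x y * g y z * h z x) ^ 2 ≤
      (∑ x, ∑ y, f x y ^ 2) * (∑ y, ∑ z, g y z ^ 2) * ∑ z, ∑ x, h z x ^ 2 := by
  have regroup : ∑ x, ∑ y, ∑ z, f x y * g y z * h z x =
      ∑ q : α × γ, (∑ y, f q.1 y * g y q.2) * h q.2 q.1 := by
    simp only [Fintype.sum_prod_type, Finset.sum_mul]
    exact Finset.sum_congr rfl fun x _ => Finset.sum_comm
  have inner_le : ∑ q : α × γ, (∑ y, f q.1 y * g y q.2) ^ 2 ≤
      (∑ x, ∑ y, f x y ^ 2) * ∑ y, ∑ z, g y z ^ 2 :=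
    calc ∑ q : α × γ, (∑ y, f q.1 y * g y q.2) ^ 2
        ≤ ∑ q : α × γ, (∑ y, f q.1 y ^ 2) * ∑ y, g y q.2 ^ 2 :=
          Finset.sum_le_sum fun q _ => Finset.sum_mul_sq_le_sq_mul_sq _ _ _
      _ = (∑ x, ∑ y, f x y ^ 2) * ∑ y, ∑ z, g y z ^ 2 := by
          rw [Fintype.sum_prod_type, Finset.sum_comm (f := fun y z => g y z ^ 2),
            Finset.sum_mul_sum]
  calc (∑ x, ∑ y, ∑ z, f x y * g y z * h z x) ^ 2
      ≤ (∑ q : α × γ, (∑ y, f q.1 y * g y q.2) ^ 2) * ∑ q : α × γ, h q.2 q.1 ^ 2 :=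
        regroup ▸ Finset.sum_mul_sq_le_sq_mul_sq _ _ _
    _ = (∑ q : α × γ, (∑ y, f q.1 y * g y q.2) ^ 2) * ∑ z, ∑ x, h z x ^ 2 := by
        rw [Fintype.sum_prod_type_right (fun q : α × γ => h q.2 q.1 ^ 2)]
    _ ≤ _ := mul_le_mul_of_nonneg_right inner_le
        (Finset.sum_nonneg fun z _ => Finset.sum_nonneg fun x _ => sq_nonneg _)

/-- A labelled loose triangle with edges of size `s + 2`: three corners `inl i`, and for each `i`
the `s` further vertices `inr (i, j)` of the edge through the corners `i` and `i + 1`, all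
distinct. -/
abbrev LooseTriangle (s : ℕ) (V : Type*) : Type _ := Fin 3 ⊕ Fin 3 × Fin s ↪ V

section Counting

variable {s : ℕ} {V : Type*}

/-- The edge of a loose triangle that contains its corners `i` and `i + 1`. -/
def LooseTriangle.edge (f : LooseTriangle s V) (i : Fin 3) : Set V :=
  f '' insert (.inl i) (insert (.inl (i + 1)) (Set.range fun j => .inr (i, j)))

lemma LooseTriangle.edge_eq (f : LooseTriangle s V) (i : Fin 3) :
    f.edge i = insert (f (.inl i)) (insert (f (.inl (i + 1)))
      (Set.range fun j => f (.inr (i, j)))) := by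
  simp only [edge, Set.image_insert_eq, ← Set.range_comp, Function.comp_def]

lemma LooseTriangle.corner_mem_edge (f : LooseTriangle s V) (i k : Fin 3) :
    f (.inl k) ∈ f.edge i ↔ k = i ∨ k = i + 1 := by
  simp [edge, f.injective.mem_set_image]

lemma LooseTriangle.edge_injective (f : LooseTriangle s V) : Function.Injective f.edge := by
  intro i j hij
  have h : ∀ k, (k = i ∨ k = i + 1) ↔ (k = j ∨ k = j + 1) := fun k => by
    rw [← f.corner_mem_edge, hij, f.corner_mem_edge]
  clear hij
  revert i j
  decide

lemma LooseTriangle.ncard_edge (f : LooseTriangle s V) (i : Fin 3) :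
    (f.edge i).ncard = s + 2 := by
  have hj : Function.Injective fun j : Fin s => (.inr (i, j) : Fin 3 ⊕ Fin 3 × Fin s) :=
    Sum.inr_injective.comp (Prod.mk_right_injective i)
  rw [edge, Set.ncard_image_of_injective _ f.injective, Set.ncard_insert_of_notMem (by simp),
    Set.ncard_insert_of_notMem (by simp), ← Set.image_univ, Set.ncard_image_of_injective _ hj]
  simp

variable (s) in
/-- The loose triangles all of whose edges belong to `E`. -/
def looseTriangles (E : Set (Set V)) : Set (LooseTriangle s V) := {f | ∀ i, f.edge i ∈ E}

variable (s) in
/-- The ordered `s`-tuples that complete the pair `u, v` to an edge in `E`. -/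
def completions (E : Set (Set V)) (u v : V) : Set (Fin s → V) :=
  {a | insert u (insert v (Set.range a)) ∈ E}

lemma ncard_setOf_range_mem_le {ι : Type*} [Fintype ι] [Finite V] (E : Set (Set V)) :
    {g : ι → V | Set.range g ∈ E}.ncard ≤ Fintype.card ι ^ Fintype.card ι * E.ncard := by
  classical
  rcases isEmpty_or_nonempty (ι → V) with _ | _
  · simp [Set.eq_empty_of_isEmpty]
  -- A tuple with range `e` is a reparametrization of one chosen enumeration of `e`.
  let enum : Set V → ι → V := Function.invFun Set.range
  have hsub : {g : ι → V | Set.range g ∈ E} ⊆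
      (fun q : (ι → ι) × Set V => enum q.2 ∘ q.1) '' (Set.univ ×ˢ E) := by
    intro g hg
    have henum : Set.range (enum (Set.range g)) = Set.range g := Function.invFun_eq ⟨g, rfl⟩
    obtain ⟨σ, hσ⟩ := Set.range_subset_range_iff_exists_comp.1 henum.ge
    exact ⟨(σ, Set.range g), ⟨trivial, hg⟩, hσ.symm⟩
  calc {g : ι → V | Set.range g ∈ E}.ncard
      ≤ ((Set.univ : Set (ι → ι)) ×ˢ E).ncard :=
        (Set.ncard_le_ncard hsub).trans Set.ncard_image_le
    _ = Fintype.card ι ^ Fintype.card ι * E.ncard := by simp [Set.ncard_prod, Set.ncard_univ]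

variable [Fintype V] (E : Set (Set V))

lemma ncard_completions_le (u v : V) : (completions s E u v).ncard ≤ Fintype.card V ^ s := by
  simpa using Set.ncard_le_card (completions s E u v)

lemma sum_ncard_completions_le :
    ∑ u, ∑ v, (completions s E u v).ncard ≤ (s + 2) ^ (s + 2) * E.ncard := by
  let tuple (q : Σ p : V × V, completions s E p.1 p.2) :
      {g : Fin (s + 2) → V | Set.range g ∈ E} :=
    ⟨Fin.cons q.1.1 (Fin.cons q.1.2 q.2.1 : Fin (s + 1) → V), by
      rw [Set.mem_ofPred_eq, Fin.range_cons, Fin.range_cons]; exact q.2.2⟩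
  have htuple : Function.Injective tuple := by
    rintro ⟨⟨u, v⟩, a, ha⟩ ⟨⟨u', v'⟩, a', ha'⟩ h
    simp only [tuple, Subtype.mk.injEq, Fin.cons_inj] at h
    obtain ⟨rfl, rfl, rfl⟩ := h
    rfl
  calc ∑ u, ∑ v, (completions s E u v).ncard
      = Nat.card (Σ p : V × V, completions s E p.1 p.2) := by
        simp only [Nat.card_sigma, Fintype.sum_prod_type, Nat.card_coe_set_eq]
    _ ≤ {g : Fin (s + 2) → V | Set.range g ∈ E}.ncard :=
        Nat.card_le_card_of_injective tuple htuple
    _ ≤ (s + 2) ^ (s + 2) * E.ncard := by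
        simpa using ncard_setOf_range_mem_le (ι := Fin (s + 2)) E

lemma ncard_looseTriangles_le_sum :
    (looseTriangles s E).ncard ≤ ∑ x, ∑ y, ∑ z, (completions s E x y).ncard *
      (completions s E y z).ncard * (completions s E z x).ncard := by
  let rows (f : looseTriangles s E) : Σ q : V × V × V,
      (completions s E q.1 q.2.1 × completions s E q.2.1 q.2.2) × completions s E q.2.2 q.1 :=
    have mem (i : Fin 3) : (fun j => f.1 (.inr (i, j))) ∈
        completions s E (f.1 (.inl i)) (f.1 (.inl (i + 1))) := by
      rw [completions, Set.mem_ofPred_eq, ← f.1.edge_eq i]; exact f.2 i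
    ⟨(f.1 (.inl 0), f.1 (.inl 1), f.1 (.inl 2)), (⟨_, mem 0⟩, ⟨_, mem 1⟩), ⟨_, mem 2⟩⟩
  have hrows : Function.Injective rows := by
    refine .of_comp (f := fun q => (q.1, q.2.1.1.1, q.2.1.2.1, q.2.2.1)) fun f g h => ?_
    simp only [Function.comp_apply, rows, Prod.mk.injEq, funext_iff] at h
    obtain ⟨⟨h0, h1, h2⟩, h3, h4, h5⟩ := h
    refine Subtype.ext (Function.Embedding.ext ?_)
    rintro (i | ⟨i, j⟩) <;> fin_cases i
    exacts [h0, h1, h2, h3 j, h4 j, h5 j]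
  calc (looseTriangles s E).ncard
      ≤ Nat.card (Σ q : V × V × V, (completions s E q.1 q.2.1 × completions s E q.2.1 q.2.2) ×
          completions s E q.2.2 q.1) := Nat.card_le_card_of_injective rows hrows
    _ = _ := by
        simp only [Nat.card_sigma, Nat.card_prod, Fintype.sum_prod_type, Nat.card_coe_set_eq]

lemma ncard_looseTriangles_rpow_le :
    ((looseTriangles s E).ncard : ℝ) ^ (2 / 3 : ℝ) ≤
      ((s : ℝ) + 2) ^ (s + 2) * (Fintype.card V : ℝ) ^ s * E.ncard := by
  let w (u v : V) : ℕ := (completions s E u v).ncard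
  have sum_sq_le : ∑ u, ∑ v, (w u v : ℝ) ^ 2 ≤
      ((s : ℝ) + 2) ^ (s + 2) * (Fintype.card V : ℝ) ^ s * E.ncard :=
    calc ∑ u, ∑ v, (w u v : ℝ) ^ 2
        ≤ ∑ u, ∑ v, (Fintype.card V : ℝ) ^ s * (w u v : ℝ) := by
          gcongr with u _ v _
          rw [sq]
          gcongr
          exact_mod_cast ncard_completions_le E u v
      _ = (Fintype.card V : ℝ) ^ s * ∑ u, ∑ v, (w u v : ℝ) := by simp only [Finset.mul_sum]
      _ ≤ (Fintype.card V : ℝ) ^ s * (((s : ℝ) + 2) ^ (s + 2) * E.ncard) := by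
          gcongr
          exact_mod_cast sum_ncard_completions_le E
      _ = _ := by ring
  have sq_le : ((looseTriangles s E).ncard : ℝ) ^ 2 ≤ (∑ u, ∑ v, (w u v : ℝ) ^ 2) ^ 3 :=
    calc ((looseTriangles s E).ncard : ℝ) ^ 2
        ≤ (∑ x, ∑ y, ∑ z, (w x y : ℝ) * w y z * w z x) ^ 2 := by
          gcongr
          exact_mod_cast ncard_looseTriangles_le_sum E
      _ ≤ _ := (sq_sum_mul_mul_le (fun u v => (w u v : ℝ)) _ _).trans_eq (by ring)
  calc ((looseTriangles s E).ncard : ℝ) ^ (2 / 3 : ℝ)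
      = (((looseTriangles s E).ncard : ℝ) ^ 2) ^ ((3 : ℕ) : ℝ)⁻¹ := by
        rw [← Real.rpow_natCast_mul (by positivity)]; norm_num
    _ ≤ ((∑ u, ∑ v, (w u v : ℝ) ^ 2) ^ 3) ^ ((3 : ℕ) : ℝ)⁻¹ := by gcongr
    _ = ∑ u, ∑ v, (w u v : ℝ) ^ 2 :=
        Real.pow_rpow_inv_natCast (by positivity) three_ne_zero
    _ ≤ _ := sum_sq_le

end Counting

/-! ### The loose triangles that a solution of triangle listing covers -/

section Listing

variable {n s : ℕ} {K : TriangleKind} {H : Hypergraph (Fin n)}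

/-- A loose triangle as a closed path of length three. -/
def LooseTriangle.toTriple (f : LooseTriangle s (Fin n)) : Triple n where
  v i := f (.inl i)
  e := f.edge

lemma LooseTriangle.isTriangle_toTriple {f : LooseTriangle s (Fin n)}
    (hf : f ∈ looseTriangles s H.edgeSet) (K : TriangleKind) : IsTriangle H f.toTriple K := by
  have isClosedPath : f.toTriple.IsClosedPath H := fun i =>
    ⟨hf i, (f.corner_mem_edge _ _).2 (.inr (sub_add_cancel i 1).symm),
      (f.corner_mem_edge _ _).2 (.inl rfl)⟩
  have isSimple : f.toTriple.IsSimple :=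
    ⟨f.injective.comp Sum.inl_injective, f.edge_injective⟩
  have isInduced : ∀ i, f.toTriple.v i ∉ f.toTriple.e (i + 1) := fun i hi => by
    have := (f.corner_mem_edge _ _).1 hi
    clear hi
    revert i
    decide
  cases K
  exacts [isClosedPath, ⟨isClosedPath, isSimple⟩, ⟨isClosedPath, isSimple, isInduced⟩]

lemma IsTriangle.e_mem_edgeSet {T : Triple n} (hT : IsTriangle H T K) (i : Fin 3) :
    T.e i ∈ H.edgeSet := by
  cases K
  exacts [(hT i).1, (hT.1 i).1, (hT.1 i).1]

lemma Triple.Same.range_e {T T' : Triple n} (h : T.Same T') :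
    Set.range T'.e = Set.range T.e := by
  rcases h with ⟨k, h⟩ | ⟨k, h⟩
  · rw [show T'.e = T.e ∘ Equiv.addLeft k from funext fun i => (h i).2,
      (Equiv.addLeft k).surjective.range_comp]
  · rw [show T'.e = T.e ∘ (Equiv.subLeft k).trans (Equiv.subRight 1) from
      funext fun i => (h i).2, (Equiv.surjective _).range_comp]

/-- The edges that occur in the triangles of a set of triangles. -/
def edgesOf (S : Set (Triple n)) : Set (Set (Fin n)) := ⋃ T ∈ S, Set.range T.e

namespace ListsTriangles

variable {S : Fin n → Set (Triple n)}

lemma edgesOf_subset (hS : ListsTriangles K H S) (v : Fin n) : edgesOf (S v) ⊆ H.edgeSet :=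
  Set.iUnion₂_subset fun T hT => Set.range_subset_iff.2 (hS.1 v T hT).e_mem_edgeSet

lemma looseTriangles_subset (hS : ListsTriangles K H S) :
    looseTriangles s H.edgeSet ⊆ ⋃ v, looseTriangles s (edgesOf (S v)) := by
  intro f hf
  obtain ⟨v, T, hT, hsame⟩ := hS.2 _ (LooseTriangle.isTriangle_toTriple hf K)
  exact Set.mem_iUnion.2 ⟨v, fun i => Set.mem_biUnion hT (hsame.range_e ▸ ⟨i, rfl⟩)⟩

lemma exists_ncard_looseTriangles_ge (hS : ListsTriangles K H S) (hn : 0 < n) :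
    ∃ v, ((looseTriangles s H.edgeSet).ncard : ℝ) / n ≤
      (looseTriangles s (edgesOf (S v))).ncard := by
  have : NeZero n := ⟨hn.ne'⟩
  have total : (looseTriangles s H.edgeSet).ncard ≤
      ∑ v, (looseTriangles s (edgesOf (S v))).ncard :=
    (Set.ncard_le_ncard hS.looseTriangles_subset).trans (Set.ncard_iUnion_le_of_fintype _)
  obtain ⟨v, -, hv⟩ := Finset.exists_le_of_sum_le (s := Finset.univ)
    (f := fun _ : Fin n => ((looseTriangles s H.edgeSet).ncard : ℝ) / n)
    (g := fun v => ((looseTriangles s (edgesOf (S v))).ncard : ℝ)) Finset.univ_nonempty (by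
      rw [Finset.sum_const, Finset.card_univ, Fintype.card_fin, nsmul_eq_mul,
        mul_div_cancel₀ _ (by positivity)]
      exact_mod_cast total)
  exact ⟨v, hv⟩

end ListsTriangles

end Listing

/-! ### The random hypergraph -/

section RandomHypergraph

lemma setBernoulli_real_superset {ι : Type*} {u F : Set ι} (p : unitInterval) (hF : F.Finite)
    (hFu : F ⊆ u) : (setBernoulli u p).real {t | F ⊆ t} = (p : ℝ) ^ F.ncard := by
  lift F to Finset ι using hF
  have cylinder : (fun q : ι → Prop => {i | q i}) ⁻¹' {t | (F : Set ι) ⊆ t} =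
      Set.pi F fun _ => {True} := by
    ext q
    simp [Set.subset_def]
  have factor : ∀ i ∈ F, (unitInterval.toNNReal p • Measure.dirac (i ∈ u) +
      unitInterval.toNNReal (unitInterval.symm p) • Measure.dirac False) {True} =
        unitInterval.toNNReal p := fun i hi => by
    simp [show i ∈ u from hFu hi]
  rw [measureReal_def, setBernoulli_apply', cylinder,
    Measure.infinitePi_pi _ fun _ _ => .of_discrete, Finset.prod_congr rfl factor]
  simp

lemma mul_measureReal_lt_le {Ω : Type*} [MeasurableSpace Ω] {μ : Measure Ω}
    [IsProbabilityMeasure μ] {X : Ω → ℝ} {a N : ℝ} (hX : Integrable X μ) (hN : ∀ ω, X ω ≤ N)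
    (ha : a ≤ N) : (N - a) * μ.real {ω | X ω < a} ≤ N - ∫ ω, X ω ∂μ :=
  calc (N - a) * μ.real {ω | X ω < a}
      ≤ (N - a) * μ.real {ω | N - a ≤ N - X ω} :=
        mul_le_mul_of_nonneg_left
          (measureReal_mono fun ω hω => sub_le_sub_left (le_of_lt hω) N) (sub_nonneg.2 ha)
    _ ≤ ∫ ω, (N - X ω) ∂μ := mul_meas_ge_le_integral_of_nonneg
        (.of_forall fun ω => sub_nonneg.2 (hN ω)) ((integrable_const N).sub hX) _
    _ = N - ∫ ω, X ω ∂μ := by simp [integral_sub (integrable_const N) hX]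

instance instDiscreteMeasurableSpaceHypergraph (n : ℕ) :
    DiscreteMeasurableSpace (Hypergraph (Fin n)) := ⟨fun _ => trivial⟩

instance instFiniteHypergraph (n : ℕ) : Finite (Hypergraph (Fin n)) :=
  .of_injective (fun H => (H.vertexSet, H.edgeSet)) fun _ _ h =>
    Hypergraph.ext (congrArg Prod.fst h) (congrArg Prod.snd h)

variable (n r : ℕ) (p : unitInterval)

lemma ae_randomHypergraph_ncard_eq :
    ∀ᵐ H ∂randomHypergraph n r p, ∀ e ∈ H.edgeSet, e.ncard = r :=
  (ae_map_iff Measurable.of_discrete.aemeasurable .of_discrete).2 setBernoulli_ae_subset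

variable {n r} in
lemma randomHypergraph_real_superset {F : Set (Set (Fin n))} (hF : ∀ e ∈ F, e.ncard = r) :
    (randomHypergraph n r p).real {H | F ⊆ H.edgeSet} = (p : ℝ) ^ F.ncard := by
  rw [randomHypergraph, map_measureReal_apply .of_discrete .of_discrete]
  exact setBernoulli_real_superset p F.toFinite hF

lemma randomHypergraph_real_superset_le (F : Set (Set (Fin n))) :
    (randomHypergraph n r p).real {H | F ⊆ H.edgeSet} ≤ (p : ℝ) ^ F.ncard := by
  by_cases hF : ∀ e ∈ F, e.ncard = r
  · exact (randomHypergraph_real_superset p hF).le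
  · have null : ∀ᵐ H ∂randomHypergraph n r p, ¬ F ⊆ H.edgeSet := by
      filter_upwards [ae_randomHypergraph_ncard_eq n r p] with H hH hFH
      exact hF fun e he => hH e (hFH he)
    rw [measureReal_def, show randomHypergraph n r p {H | F ⊆ H.edgeSet} = 0 by
      simpa using ae_iff.1 null, ENNReal.toReal_zero]
    have := p.2.1
    positivity

variable {n} in
lemma randomHypergraph_real_mem_looseTriangles {s : ℕ} (f : LooseTriangle s (Fin n)) :
    (randomHypergraph n (s + 2) p).real {H | f ∈ looseTriangles s H.edgeSet} = (p : ℝ) ^ 3 := by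
  have heq : {H : Hypergraph (Fin n) | f ∈ looseTriangles s H.edgeSet} =
      {H | Set.range f.edge ⊆ H.edgeSet} := by
    ext H
    simp [looseTriangles, Set.range_subset_iff]
  have hcard : (Set.range f.edge).ncard = 3 := by
    rw [← Set.image_univ, Set.ncard_image_of_injective _ f.edge_injective]
    simp
  rw [heq, randomHypergraph_real_superset p (Set.forall_mem_range.2 f.ncard_edge), hcard]

lemma integral_ncard_looseTriangles (s : ℕ) :
    ∫ H, ((looseTriangles s H.edgeSet).ncard : ℝ) ∂randomHypergraph n (s + 2) p =
      p ^ 3 * Nat.card (LooseTriangle s (Fin n)) := by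
  classical
  have sum_indicator : ∀ H : Hypergraph (Fin n), ((looseTriangles s H.edgeSet).ncard : ℝ) =
      ∑ f, {H : Hypergraph (Fin n) | f ∈ looseTriangles s H.edgeSet}.indicator 1 H := fun H => by
    rw [Set.ncard_eq_toFinset_card']
    simp [Set.indicator_apply]
  simp_rw [sum_indicator]
  rw [integral_finsetSum _ fun f _ => .of_finite]
  simp_rw [integral_indicator_one MeasurableSet.of_discrete,
    randomHypergraph_real_mem_looseTriangles]
  simp [mul_comm]

variable {n} in
lemma randomHypergraph_real_ncard_looseTriangles_lt {s : ℕ} (hn : 3 * (s + 1) ≤ n) :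
    (randomHypergraph n (s + 2) p).real {H | ((looseTriangles s H.edgeSet).ncard : ℝ) <
      p ^ 3 / 2 * Nat.card (LooseTriangle s (Fin n))} ≤ 1 - p ^ 3 / 2 := by
  have hp : (p : ℝ) ^ 3 ≤ 1 := pow_le_one₀ p.2.1 p.2.2
  have : Nonempty (LooseTriangle s (Fin n)) :=
    Function.Embedding.nonempty_of_card_le (by simp; omega)
  have hN : (0 : ℝ) < Nat.card (LooseTriangle s (Fin n)) := by exact_mod_cast Nat.card_pos
  set N : ℝ := ((Nat.card (LooseTriangle s (Fin n)) : ℕ) : ℝ)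
  set P : ℝ := (randomHypergraph n (s + 2) p).real
    {H | ((looseTriangles s H.edgeSet).ncard : ℝ) < p ^ 3 / 2 * N}
  have markov : (N - p ^ 3 / 2 * N) * P ≤ N - p ^ 3 * N :=
    integral_ncard_looseTriangles n p s ▸ mul_measureReal_lt_le .of_finite
      (fun H => Nat.cast_le.2 (Set.ncard_le_card _)) (by nlinarith)
  have : (1 - p ^ 3 / 2) * P ≤ (1 - p ^ 3 / 2) * (1 - p ^ 3 / 2) := by
    refine le_of_mul_le_mul_left ?_ hN
    nlinarith [sq_nonneg ((p : ℝ) ^ 3)]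
  exact le_of_mul_le_mul_left this (by linarith)

end RandomHypergraph

/-! ### Transcripts -/

section Transcripts

/-- A message of at most `B` bits as a word of length exactly `B`, in which `none` marks the
positions beyond its end. -/
def Message.letters {B : ℕ} (m : Message B) (i : Fin B) : Option Bool := m.1[(i : ℕ)]?

lemma Message.letters_injective (B : ℕ) :
    Function.Injective (letters : Message B → Fin B → Option Bool) := by
  rintro ⟨l, hl⟩ ⟨l', hl'⟩ h
  refine Subtype.ext (List.ext_getElem? fun i => ?_)
  by_cases hi : i < B
  · exact congrFun h ⟨i, hi⟩
  · rw [List.getElem?_eq_none (hl.trans (not_lt.1 hi)),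
      List.getElem?_eq_none (hl'.trans (not_lt.1 hi))]

instance instFiniteMessage (B : ℕ) : Finite (Message B) :=
  .of_injective _ (Message.letters_injective B)

lemma card_message_le (B : ℕ) : Nat.card (Message B) ≤ 3 ^ B := by
  simpa using Nat.card_le_card_of_injective _ (Message.letters_injective B)

lemma ncard_setOf_length_eq {α : Type*} [Finite α] (T : ℕ) :
    {h : List α | h.length = T}.ncard = Nat.card α ^ T := by
  have := Fintype.ofFinite α
  rw [← Nat.card_coe_set_eq, Nat.card_eq_fintype_card (α := α), ← card_vector,
    ← Nat.card_eq_fintype_card]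
  rfl

lemma ncard_setOf_ncard_eq_mem_le {n : ℕ} (k : ℕ) (v : Fin n) :
    {e : Set (Fin n) | e.ncard = k + 1 ∧ v ∈ e}.ncard ≤ n ^ k := by
  have hsub : {e : Set (Fin n) | e.ncard = k + 1 ∧ v ∈ e} ⊆
      insert v '' {t | t ⊆ Set.univ ∧ t.ncard = k} := fun e ⟨he, hv⟩ =>
    ⟨e \ {v}, ⟨Set.subset_univ _, by rw [Set.ncard_sdiff_singleton_of_mem hv, he]; rfl⟩,
      Set.insert_sdiff_self_of_mem hv⟩
  calc {e : Set (Fin n) | e.ncard = k + 1 ∧ v ∈ e}.ncard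
      ≤ {t : Set (Fin n) | t ⊆ Set.univ ∧ t.ncard = k}.ncard :=
        (Set.ncard_le_ncard hsub).trans Set.ncard_image_le
    _ = n.choose k := by
        rw [Set.ncard_powerset_ncard Set.finite_univ, Set.ncard_univ, Nat.card_fin]
    _ ≤ n ^ k := Nat.choose_le_pow n k

lemma randomHypergraph_real_guess_le {n : ℕ} (r : ℕ) (p : unitInterval) {α : Type*} {J : Set α}
    (hJ : J.Finite) {τ : Hypergraph (Fin n) → α} (hτ : ∀ᵐ H ∂randomHypergraph n r p, τ H ∈ J)
    (Φ : α → Set (Set (Fin n))) {x : ℝ} (hp : 0 < p) :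
    (randomHypergraph n r p).real {H | Φ (τ H) ⊆ H.edgeSet ∧ x ≤ (Φ (τ H)).ncard} ≤
      J.ncard * (p : ℝ) ^ x := by
  lift J to Finset α using hJ
  have cover : {H | Φ (τ H) ⊆ H.edgeSet ∧ x ≤ (Φ (τ H)).ncard} ≤ᵐ[randomHypergraph n r p]
      ⋃ a ∈ J, {H | Φ a ⊆ H.edgeSet ∧ x ≤ (Φ a).ncard} := by
    filter_upwards [hτ] with H hH h
    exact Set.mem_biUnion hH h
  have guess (a : α) : (randomHypergraph n r p).real
      {H | Φ a ⊆ H.edgeSet ∧ x ≤ (Φ a).ncard} ≤ (p : ℝ) ^ x := by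
    by_cases hx : x ≤ (Φ a).ncard
    · simp only [hx, and_true]
      calc (randomHypergraph n r p).real {H | Φ a ⊆ H.edgeSet} ≤ (p : ℝ) ^ (Φ a).ncard :=
            randomHypergraph_real_superset_le n r p _
        _ ≤ (p : ℝ) ^ x := by
            rw [← Real.rpow_natCast]
            exact Real.rpow_le_rpow_of_exponent_ge hp p.2.2 hx
    · simp only [hx, and_false, Set.ofPred_false, measureReal_empty]
      exact Real.rpow_nonneg p.2.1 x
  calc _ ≤ (randomHypergraph n r p).real (⋃ a ∈ J, {H | Φ a ⊆ H.edgeSet ∧ x ≤ (Φ a).ncard}) :=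
        ENNReal.toReal_mono (measure_ne_top _ _) (measure_mono_ae cover)
    _ ≤ ∑ _a ∈ J, (p : ℝ) ^ x :=
        (measureReal_biUnion_finset_le _ _).trans (Finset.sum_le_sum fun a _ => guess a)
    _ = _ := by simp

end Transcripts

namespace Algorithm

variable {n B : ℕ} {Ω : Type*} [MeasurableSpace Ω] (A : Algorithm n B Ω) (M : Model)
  {H : Hypergraph (Fin n)} {ω : Ω} {v : Fin n}

lemma length_history (t : ℕ) : (A.history M H ω t v).length = t := by
  induction t with
  | zero => rfl
  | succ t ih => simp [history, ih]

lemma inits_history (T : ℕ) : (A.history M H ω T v).inits =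
    (List.range (T + 1)).map fun t => A.history M H ω t v := by
  induction T with
  | zero => rfl
  | succ T ih => rw [List.range_succ, List.map_append, ← ih, history, List.inits_append]; rfl

/-- The output with which `v` terminates while it receives the history `h`, and `none` if `v` is
still undecided after `h`. -/
def firstDecision (v : Fin n) (ω : Ω) (I : Set (Set (Fin n))) (h : History n B) :
    Option (Set (Triple n)) :=
  h.inits.findSome? (A.decide v ω I)

/-- The edges of the triangles that `v` lists on a given transcript; none if it does not terminate
within it. -/
def listedEdges (v : Fin n) (ω : Ω) (q : Set (Set (Fin n)) × History n B) : Set (Set (Fin n)) :=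
  edgesOf ((A.firstDecision v ω q.1 q.2).getD ∅)

/-- What `v` knows after `T` rounds, apart from the random choices. -/
noncomputable def transcript (T : ℕ) (v : Fin n) (ω : Ω) (H : Hypergraph (Fin n)) :
    Set (Set (Fin n)) × History n B :=
  (incidentEdges H v, A.history M H ω T v)

/-- The transcripts of `T` rounds that `v` may have in an `r`-uniform hypergraph. -/
def transcripts (n B r T : ℕ) (v : Fin n) : Set (Set (Set (Fin n)) × History n B) :=
  (𝒫 {e | e.ncard = r ∧ v ∈ e}) ×ˢ {h | h.length = T}

variable {A M}

lemma TerminatesWith.firstDecision_eq {t T : ℕ} {S : Set (Triple n)}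
    (h : A.TerminatesWith M H ω v t S) (ht : t ≤ T) :
    A.firstDecision v ω (incidentEdges H v) (A.history M H ω T v) = some S := by
  obtain ⟨k, rfl⟩ := Nat.exists_eq_add_of_le ht
  have undecided : (List.range t).findSome? (fun s => A.decision M H ω s v) = none :=
    List.findSome?_eq_none_iff.2 fun s hs => h.2 s (List.mem_range.1 hs)
  rw [firstDecision, inits_history, List.findSome?_map]
  change (List.range (t + k + 1)).findSome? (fun s => A.decision M H ω s v) = some S
  rw [add_assoc, List.range_add, List.findSome?_append, undecided, List.range_succ_eq_map]
  simp [h.1]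

lemma TerminatesWith.unique {t t' : ℕ} {S S' : Set (Triple n)}
    (h : A.TerminatesWith M H ω v t S) (h' : A.TerminatesWith M H ω v t' S') : S = S' :=
  Option.some_injective _ <| (h.firstDecision_eq (le_max_left t t')).symm.trans
    (h'.firstDecision_eq (le_max_right t t'))

lemma rounds_le_iff {T : ℕ} : A.rounds M H ω ≤ T ↔
    ∀ v, ∃ t ≤ T, ∃ S, A.TerminatesWith M H ω v t S := by
  refine iSup_le_iff.trans (forall_congr' fun v => ?_)
  rw [← ENat.lt_natCast_add_one_iff, sInf_lt_iff]
  constructor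
  · rintro ⟨_, ⟨t, S, h, rfl⟩, ht⟩
    exact ⟨t, by simpa [ENat.lt_natCast_add_one_iff] using ht, S, h⟩
  · rintro ⟨t, ht, S, h⟩
    exact ⟨t, ⟨t, S, h, rfl⟩, by simpa [ENat.lt_natCast_add_one_iff] using ht⟩

lemma exists_listsTriangles {K : TriangleKind} {T : ℕ} (hs : A.Succeeds M K H ω)
    (hT : A.rounds M H ω ≤ T) : ∃ S, ListsTriangles K H S ∧
      ∀ v, edgesOf (S v) = A.listedEdges v ω (A.transcript M T v ω H) := by
  obtain ⟨S, hS, hL⟩ := hs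
  refine ⟨S, hL, fun v => ?_⟩
  obtain ⟨t, ht, S', hS'⟩ := rounds_le_iff.1 hT v
  obtain ⟨_, h⟩ := hS v
  simp [listedEdges, transcript, hS'.firstDecision_eq ht, h.unique hS']

variable (v) (r T : ℕ)

lemma ncard_transcripts_le (k : ℕ) :
    (transcripts n B (k + 1) T v).ncard ≤ 2 ^ n ^ k * 3 ^ (B * n * T) := by
  rw [transcripts, Set.ncard_prod, Set.ncard_powerset, ncard_setOf_length_eq, Nat.card_fun,
    Nat.card_fin, pow_mul, pow_mul]
  gcongr
  exacts [one_le_two, ncard_setOf_ncard_eq_mem_le k v, card_message_le B]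

lemma finite_transcripts : (transcripts n B r T v).Finite :=
  (Set.toFinite _).prod (List.finite_length_eq _ T)

lemma ae_transcript_mem (p : unitInterval) :
    ∀ᵐ H ∂randomHypergraph n r p, A.transcript M T v ω H ∈ transcripts n B r T v := by
  filter_upwards [ae_randomHypergraph_ncard_eq n r p] with H hH
  exact ⟨fun e he => ⟨hH e he.1, he.2⟩, A.length_history M T⟩

lemma measureReal_succeeds_rounds_le {s : ℕ} {K : TriangleKind} {p : unitInterval} {x : ℝ}
    (hp : 0 < p) (hn : 3 * (s + 1) ≤ n)
    (hx : ∀ E : Set (Set (Fin n)), (p : ℝ) ^ 3 / 2 * Nat.card (LooseTriangle s (Fin n)) / n ≤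
      (looseTriangles s E).ncard → x ≤ E.ncard) :
    (randomHypergraph n (s + 2) p).real {H | A.Succeeds M K H ω ∧ A.rounds M H ω ≤ T} ≤
      1 - p ^ 3 / 2 + n * (2 ^ n ^ (s + 1) * 3 ^ (B * n * T) * (p : ℝ) ^ x) := by
  let few : Set (Hypergraph (Fin n)) := {H | ((looseTriangles s H.edgeSet).ncard : ℝ) <
    p ^ 3 / 2 * Nat.card (LooseTriangle s (Fin n))}
  let guesses (v : Fin n) : Set (Hypergraph (Fin n)) :=
    {H | A.listedEdges v ω (A.transcript M T v ω H) ⊆ H.edgeSet ∧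
      x ≤ (A.listedEdges v ω (A.transcript M T v ω H)).ncard}
  have cover : {H | A.Succeeds M K H ω ∧ A.rounds M H ω ≤ T} ⊆ few ∪ ⋃ v, guesses v := by
    rintro H ⟨hs, hT⟩
    obtain ⟨S, hS, hlisted⟩ := exists_listsTriangles hs hT
    obtain ⟨v, hv⟩ := hS.exists_ncard_looseTriangles_ge (s := s) (by omega)
    refine or_iff_not_imp_left.2 fun hfew => Set.mem_iUnion.2 ⟨v, ?_, ?_⟩
    · exact hlisted v ▸ hS.edgesOf_subset v
    · rw [← hlisted v]
      refine hx _ (le_trans ?_ hv)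
      gcongr
      exact not_lt.1 hfew
  have guesses_le (v : Fin n) : (randomHypergraph n (s + 2) p).real (guesses v) ≤
      2 ^ n ^ (s + 1) * 3 ^ (B * n * T) * (p : ℝ) ^ x :=
    (randomHypergraph_real_guess_le (s + 2) p (finite_transcripts v _ T)
      (ae_transcript_mem v _ T p) (A.listedEdges v ω) hp).trans
        (mul_le_mul_of_nonneg_right (by exact_mod_cast ncard_transcripts_le v T (s + 1))
          (Real.rpow_nonneg p.2.1 x))
  calc _ ≤ (randomHypergraph n (s + 2) p).real few +
        ∑ v, (randomHypergraph n (s + 2) p).real (guesses v) :=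
        (measureReal_mono cover).trans ((measureReal_union_le _ _).trans
          (add_le_add_right (measureReal_iUnion_fintype_le _) _))
    _ ≤ (1 - p ^ 3 / 2) + ∑ _v : Fin n, 2 ^ n ^ (s + 1) * 3 ^ (B * n * T) * (p : ℝ) ^ x :=
        add_le_add (randomHypergraph_real_ncard_looseTriangles_lt p hn)
          (Finset.sum_le_sum fun v _ => guesses_le v)
    _ = _ := by simp

end Algorithm

/-! ### The expected number of rounds -/

instance instFiniteTriple (n : ℕ) : Finite (Triple n) :=
  .of_injective (fun T => (T.v, T.e)) fun ⟨_, _⟩ ⟨_, _⟩ h => by simpa using h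

lemma measurableSet_comp_eq {Ω β γ : Type*} [MeasurableSpace Ω] [Countable β] {g : Ω → β}
    {f : Ω → β → γ} (hg : ∀ b, MeasurableSet {ω | g ω = b})
    (hf : ∀ b c, MeasurableSet {ω | f ω b = c}) (c : γ) :
    MeasurableSet {ω | f ω (g ω) = c} := by
  have : {ω | f ω (g ω) = c} = ⋃ b, {ω | g ω = b} ∩ {ω | f ω b = c} := by
    ext ω
    simp
  rw [this]
  exact .iUnion fun b => (hg b).inter (hf b c)

lemma measurableSet_of_measurableSet_section {α Ω : Type*} [MeasurableSpace Ω] [Countable α]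
    [MeasurableSpace α] [MeasurableSingletonClass α] {X : Set (α × Ω)}
    (hX : ∀ a, MeasurableSet {ω | (a, ω) ∈ X}) : MeasurableSet X := by
  have : X = ⋃ a, {a} ×ˢ {ω | (a, ω) ∈ X} := by
    ext ⟨a, ω⟩
    simp
  rw [this]
  exact .iUnion fun a => (measurableSet_singleton a).prod (hX a)

namespace Algorithm

variable {n B : ℕ} {Ω : Type*} [MeasurableSpace Ω] (A : Algorithm n B Ω) (M : Model)

lemma measurableSet_history (H : Hypergraph (Fin n)) (t : ℕ) (v : Fin n) (h : History n B) :
    MeasurableSet {ω | A.history M H ω t v = h} := by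
  classical
  induction t generalizing v h with
  | zero => exact .const ([] = h)
  | succ t ih =>
    rcases List.eq_nil_or_concat' h with rfl | ⟨g, m, rfl⟩
    · simp [history]
    · have : {ω | A.history M H ω (t + 1) v = g ++ [m]} = {ω | A.history M H ω t v = g} ∩
          ⋂ u, {ω | (if M.CanSend H u v then A.send u v ω (incidentEdges H u)
            (A.history M H ω t u) else Message.silence) = m u} := by
        ext ω
        simp [history, funext_iff]
      rw [this]
      refine (ih v g).inter (.iInter fun u => ?_)
      split_ifs
      · exact measurableSet_comp_eq (ih u) (fun h => A.measurable_send u v _ h) (m u)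
      · exact .const _

lemma measurableSet_terminatesWith (H : Hypergraph (Fin n)) (v : Fin n) (t : ℕ)
    (S : Set (Triple n)) : MeasurableSet {ω | A.TerminatesWith M H ω v t S} := by
  have measurableSet_decision (s : ℕ) (o : Option (Set (Triple n))) :
      MeasurableSet {ω | A.decision M H ω s v = o} :=
    measurableSet_comp_eq (A.measurableSet_history M H s v) (A.measurable_decide v _) o
  simp only [TerminatesWith, Set.ofPred_and, Set.ofPred_forall]
  exact (measurableSet_decision t _).inter
    (.iInter fun s => .iInter fun _ => measurableSet_decision s _)

lemma measurableSet_succeeds (K : TriangleKind) (H : Hypergraph (Fin n)) :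
    MeasurableSet {ω | A.Succeeds M K H ω} := by
  simp only [Succeeds, Set.ofPred_exists, Set.ofPred_and, Set.ofPred_forall]
  exact .iUnion fun S => (MeasurableSet.iInter fun v => .iUnion fun t =>
    A.measurableSet_terminatesWith M H v t _).inter (.const _)

lemma measurableSet_rounds_le (T : ℕ) (H : Hypergraph (Fin n)) :
    MeasurableSet {ω | A.rounds M H ω ≤ T} := by
  simp only [rounds_le_iff, Set.ofPred_exists, Set.ofPred_and, Set.ofPred_forall]
  exact .iInter fun v => .iUnion fun t => MeasurableSet.inter (.const _) <| .iUnion fun S =>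
    A.measurableSet_terminatesWith M H v t S

lemma mul_successProbability_sub_le_expectedRounds (K : TriangleKind) (T : ℕ)
    (D : Measure (Hypergraph (Fin n))) [IsProbabilityMeasure D] (P : Measure Ω)
    [IsProbabilityMeasure P] {β : ℝ≥0∞}
    (hβ : ∀ ω, D {H | A.Succeeds M K H ω ∧ A.rounds M H ω ≤ T} ≤ β) :
    (T + 1) * (A.successProbability M K D P - β) ≤ A.expectedRounds M D P := by
  let fast : Set (Hypergraph (Fin n) × Ω) := {q | A.rounds M q.1 q.2 ≤ T}
  let success : Set (Hypergraph (Fin n) × Ω) := {q | A.Succeeds M K q.1 q.2}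
  have measurableSet_fast : MeasurableSet fast :=
    measurableSet_of_measurableSet_section fun H => A.measurableSet_rounds_le M T H
  have measurableSet_success : MeasurableSet success :=
    measurableSet_of_measurableSet_section fun H => A.measurableSet_succeeds M K H
  have success_fast_le : D.prod P (success ∩ fast) ≤ β :=
    calc D.prod P (success ∩ fast)
        = ∫⁻ ω, D {H | A.Succeeds M K H ω ∧ A.rounds M H ω ≤ T} ∂P :=
          Measure.prod_apply_symm (measurableSet_success.inter measurableSet_fast)
      _ ≤ ∫⁻ _, β ∂P := lintegral_mono hβ
      _ = β := by simp
  have sub_le_slow : A.successProbability M K D P - β ≤ D.prod P fastᶜ := by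
    refine tsub_le_iff_left.2 ?_
    calc D.prod P success ≤ D.prod P (success ∩ fast) + D.prod P (success \ fast) :=
          measure_le_inter_add_sdiff _ _ _
      _ ≤ β + D.prod P fastᶜ := add_le_add success_fast_le (measure_mono fun _ hq => hq.2)
  calc (T + 1) * (A.successProbability M K D P - β)
      ≤ (T + 1) * D.prod P fastᶜ := by gcongr
    _ = ∫⁻ _ in fastᶜ, (T + 1) ∂D.prod P := by simp
    _ ≤ ∫⁻ q in fastᶜ, ((A.rounds M q.1 q.2 : ℕ∞) : ℝ≥0∞) ∂D.prod P :=
        setLIntegral_mono' measurableSet_fast.compl fun q hq => by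
          exact_mod_cast ENat.toENNReal_le.2 (Order.add_one_le_of_lt (not_le.1 hq))
    _ ≤ A.expectedRounds M D P := setLIntegral_le_lintegral _ _

lemma ofReal_mul_sub_le_expectedRounds {K : TriangleKind} {T : ℕ}
    {D : Measure (Hypergraph (Fin n))} [IsProbabilityMeasure D] {P : Measure Ω}
    [IsProbabilityMeasure P] {q β : ℝ}
    (hβ : ∀ ω, D.real {H | A.Succeeds M K H ω ∧ A.rounds M H ω ≤ T} ≤ β)
    (hq : ENNReal.ofReal q ≤ A.successProbability M K D P) :
    ENNReal.ofReal ((T + 1) * (q - β)) ≤ A.expectedRounds M D P := by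
  obtain ⟨ω₀⟩ := P.nonempty_of_neZero
  have hβ₀ : 0 ≤ β := measureReal_nonneg.trans (hβ ω₀)
  calc ENNReal.ofReal ((T + 1) * (q - β))
      = (T + 1) * (ENNReal.ofReal q - ENNReal.ofReal β) := by
        rw [ENNReal.ofReal_mul (by positivity), ENNReal.ofReal_sub _ hβ₀]
        norm_cast
    _ ≤ (T + 1) * (A.successProbability M K D P - ENNReal.ofReal β) := by gcongr
    _ ≤ A.expectedRounds M D P :=
        A.mul_successProbability_sub_le_expectedRounds M K T D P fun ω =>
          (ENNReal.le_ofReal_iff_toReal_le (measure_ne_top _ _) hβ₀).2 (hβ ω)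

end Algorithm

/-! ### Asymptotics -/

section Asymptotics

lemma div_two_pow_le_descFactorial {n k : ℕ} (h : 2 * k ≤ n) :
    ((n : ℝ) / 2) ^ k ≤ n.descFactorial k :=
  calc ((n : ℝ) / 2) ^ k ≤ ((n + 1 - k : ℕ) : ℝ) ^ k := by
        gcongr
        rw [div_le_iff₀ two_pos]
        exact_mod_cast (by omega : n ≤ (n + 1 - k) * 2)
    _ ≤ n.descFactorial k := by exact_mod_cast Nat.pow_sub_le_descFactorial n k

lemma card_looseTriangle (s n : ℕ) :
    Nat.card (LooseTriangle s (Fin n)) = n.descFactorial (3 * (s + 1)) := by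
  rw [Nat.card_eq_fintype_card, Fintype.card_embedding_eq]
  simp [mul_add, add_comm]

/-- The constant `γ` such that `γ n ^ (s + 4 / 3)` edges of size `s + 2` are needed to span a
fraction `p ^ 3 / (2 n)` of all loose triangles on `n` vertices. -/
noncomputable def edgeConstant (s : ℕ) (p : ℝ) : ℝ :=
  (p ^ 3 / 2 ^ (3 * s + 4)) ^ (2 / 3 : ℝ) / ((s : ℝ) + 2) ^ (s + 2)

lemma edgeConstant_pos (s : ℕ) {p : ℝ} (hp : 0 < p) : 0 < edgeConstant s p := by
  unfold edgeConstant
  positivity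

lemma edgeConstant_mul_le_ncard {n s : ℕ} {p : ℝ} (hp : 0 ≤ p) (hs : 6 * (s + 1) ≤ n)
    {E : Set (Set (Fin n))} (hE : p ^ 3 / 2 * Nat.card (LooseTriangle s (Fin n)) / n ≤
      (looseTriangles s E).ncard) :
    edgeConstant s p * (n : ℝ) ^ ((s : ℝ) + 4 / 3) ≤ E.ncard := by
  have hn : (0 : ℝ) < n := by exact_mod_cast (by omega : 0 < n)
  have many : p ^ 3 / 2 ^ (3 * s + 4) * (n : ℝ) ^ (3 * s + 2) ≤ (looseTriangles s E).ncard :=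
    calc p ^ 3 / 2 ^ (3 * s + 4) * (n : ℝ) ^ (3 * s + 2)
        = p ^ 3 / 2 * ((n : ℝ) / 2) ^ (3 * (s + 1)) / n := by
          rw [div_pow]
          field_simp
          ring
      _ ≤ p ^ 3 / 2 * Nat.card (LooseTriangle s (Fin n)) / n := by
          gcongr
          rw [card_looseTriangle]
          exact div_two_pow_le_descFactorial (by omega)
      _ ≤ _ := hE
  have power : ((n : ℝ) ^ (3 * s + 2)) ^ (2 / 3 : ℝ) =
      (n : ℝ) ^ s * (n : ℝ) ^ ((s : ℝ) + 4 / 3) := by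
    rw [← Real.rpow_natCast_mul hn.le, ← Real.rpow_natCast, ← Real.rpow_add hn]
    congr 1
    push_cast
    ring
  have spanned : (p ^ 3 / 2 ^ (3 * s + 4)) ^ (2 / 3 : ℝ) *
      ((n : ℝ) ^ s * (n : ℝ) ^ ((s : ℝ) + 4 / 3)) ≤ ((s : ℝ) + 2) ^ (s + 2) * n ^ s * E.ncard :=
    calc _ = (p ^ 3 / 2 ^ (3 * s + 4) * (n : ℝ) ^ (3 * s + 2)) ^ (2 / 3 : ℝ) := by
          rw [Real.mul_rpow (by positivity) (by positivity), power]
      _ ≤ ((looseTriangles s E).ncard : ℝ) ^ (2 / 3 : ℝ) := by gcongr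
      _ ≤ _ := by simpa using ncard_looseTriangles_rpow_le (s := s) E
  rw [edgeConstant, div_mul_eq_mul_div, div_le_iff₀ (by positivity)]
  refine le_of_mul_le_mul_left ?_ (pow_pos hn s)
  linarith

lemma mul_two_pow_mul_three_pow_mul_rpow_le {p ε x : ℝ} (hp : 0 < p) (hε : 0 < ε) {n a b : ℕ}
    (h : n + a + 2 * b - Real.log ε ≤ -Real.log p * x) :
    n * (2 ^ a * 3 ^ b * p ^ x) ≤ ε := by
  have hn : (n : ℝ) ≤ Real.exp n := by linarith [Real.add_one_le_exp (n : ℝ)]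
  have two_le : (2 : ℝ) ≤ Real.exp 1 := by linarith [Real.add_one_le_exp (1 : ℝ)]
  have three_le : (3 : ℝ) ≤ Real.exp 2 := by linarith [Real.add_one_le_exp (2 : ℝ)]
  calc n * (2 ^ a * 3 ^ b * p ^ x)
      ≤ Real.exp n * (Real.exp 1 ^ a * Real.exp 2 ^ b * Real.exp (Real.log p * x)) := by
        rw [Real.rpow_def_of_pos hp]
        gcongr
    _ = Real.exp (n + a + 2 * b + Real.log p * x) := by
        rw [← Real.exp_nat_mul, ← Real.exp_nat_mul, ← Real.exp_add, ← Real.exp_add,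
          ← Real.exp_add]
        ring_nf
    _ ≤ Real.exp (Real.log ε) := Real.exp_le_exp.2 (by linarith)
    _ = ε := Real.exp_log hε

lemma exists_eventually_communication_le (s : ℕ) (C k : ℝ) {μ : ℝ} (hμ : 0 < μ) :
    ∃ c > 0, ∀ᶠ n : ℕ in atTop, ∀ B T : ℕ, (B : ℝ) ≤ C * Real.log n →
      (T : ℝ) ≤ c * ((n : ℝ) ^ ((s : ℝ) + 1 / 3) / Real.log n) →
      n + n ^ (s + 1) + 2 * (B * n * T) + k ≤ μ * (n : ℝ) ^ ((s : ℝ) + 4 / 3) := by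
  refine ⟨μ / (4 * (|C| + 1)), by positivity, ?_⟩
  have tendsto_root : Tendsto (fun n : ℕ => (n : ℝ) ^ (1 / 3 : ℝ)) atTop atTop :=
    (tendsto_rpow_atTop (by norm_num)).comp tendsto_natCast_atTop_atTop
  filter_upwards [eventually_gt_atTop 1,
    tendsto_root.eventually_ge_atTop ((2 + |k|) / (μ / 2))] with n hn hroot B T hB hT
  have hn : (1 : ℝ) < n := by exact_mod_cast hn
  have hn₀ : (0 : ℝ) < n := by positivity
  have hlog : 0 < Real.log n := Real.log_pos hn
  set y := (n : ℝ) ^ ((s : ℝ) + 1 / 3)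
  have raise : (n : ℝ) ^ ((s : ℝ) + 4 / 3) = n * y := by
    rw [← Real.rpow_one_add' hn₀.le (by positivity)]
    ring_nf
  have split : (n : ℝ) ^ ((s : ℝ) + 4 / 3) = n ^ (s + 1) * (n : ℝ) ^ (1 / 3 : ℝ) := by
    rw [← Real.rpow_natCast, ← Real.rpow_add hn₀]
    push_cast
    ring_nf
  have bits_le : (B : ℝ) * T ≤ μ / 4 * y :=
    calc (B : ℝ) * T
        ≤ ((|C| + 1) * Real.log n) * (μ / (4 * (|C| + 1)) * (y / Real.log n)) := by
          gcongr
          exact hB.trans (by gcongr; linarith [le_abs_self C])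
      _ = μ / 4 * y := by field_simp
  have initial_le : n + n ^ (s + 1) + k ≤ μ / 2 * (n : ℝ) ^ ((s : ℝ) + 4 / 3) :=
    calc (n : ℝ) + n ^ (s + 1) + k
        ≤ n ^ (s + 1) + n ^ (s + 1) + |k| * n ^ (s + 1) := by
          gcongr
          · exact le_self_pow₀ hn.le s.succ_ne_zero
          · exact (le_abs_self k).trans
              (le_mul_of_one_le_right (abs_nonneg k) (one_le_pow₀ hn.le))
      _ = (2 + |k|) * n ^ (s + 1) := by ring
      _ ≤ μ / 2 * (n : ℝ) ^ (1 / 3 : ℝ) * n ^ (s + 1) := by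
          gcongr
          exact (div_le_iff₀' (by positivity)).1 hroot
      _ = _ := by rw [split]; ring
  have := mul_le_mul_of_nonneg_left bits_le hn₀.le
  rw [raise] at initial_le ⊢
  linarith

end Asymptotics

lemma exists_eventually_measureReal_succeeds_rounds_le (s : ℕ) {p : unitInterval} (hp₀ : 0 < p)
    (hp₁ : p < 1) (C : ℝ) {ε : ℝ} (hε : 0 < ε) :
    ∃ c > 0, ∀ᶠ n : ℕ in atTop, ∀ B T : ℕ, (B : ℝ) ≤ C * Real.log n →
      (T : ℝ) ≤ c * ((n : ℝ) ^ ((s : ℝ) + 1 / 3) / Real.log n) →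
      ∀ (Ω : Type*) [MeasurableSpace Ω] (A : Algorithm n B Ω) (M : Model) (K : TriangleKind)
        (ω : Ω), (randomHypergraph n (s + 2) p).real
          {H | A.Succeeds M K H ω ∧ A.rounds M H ω ≤ T} ≤ 1 - p ^ 3 / 2 + ε := by
  have hγ : 0 < -Real.log p * edgeConstant s p :=
    mul_pos (neg_pos.2 (Real.log_neg hp₀ hp₁)) (edgeConstant_pos s hp₀)
  obtain ⟨c, hc, communication_le⟩ := exists_eventually_communication_le s C (-Real.log ε) hγ
  refine ⟨c, hc, ?_⟩
  filter_upwards [communication_le, eventually_ge_atTop (6 * (s + 1))]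
    with n budget hn B T hB hT Ω _ A M K ω
  refine (A.measureReal_succeeds_rounds_le T hp₀ (by omega) fun E =>
    edgeConstant_mul_le_ncard p.2.1 hn).trans (add_le_add_right ?_ _)
  refine mul_two_pow_mul_three_pow_mul_rpow_le hp₀ hε ?_
  have := budget B T hB hT
  push_cast
  linarith

end HypergraphTriangles

theorem theorem3p2_general (r : ℕ) (hr : 2 ≤ r) (p : unitInterval) (hp₀ : 0 < p) (hp₁ : p < 1) :
    ∃ q : ℝ, 0 < q ∧ q < 1 ∧
      ∀ C : ℝ, ∃ c : ℝ, 0 < c ∧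
        ∀ᶠ n : ℕ in atTop, ∀ B : ℕ, (B : ℝ) ≤ C * Real.log n →
          ∀ (Ω : Type*) [MeasurableSpace Ω] (P : Measure Ω) [IsProbabilityMeasure P]
            (A : HypergraphTriangles.Algorithm n B Ω) (M : HypergraphTriangles.Model)
            (K : HypergraphTriangles.TriangleKind),
            ENNReal.ofReal q ≤ A.successProbability M K
                (HypergraphTriangles.randomHypergraph n r p) P →
            ENNReal.ofReal (c * ((n : ℝ) ^ ((r : ℝ) - 5 / 3) / Real.log n)) ≤
              A.expectedRounds M (HypergraphTriangles.randomHypergraph n r p) P := by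
  obtain ⟨s, rfl⟩ := Nat.exists_eq_add_of_le' hr
  have hp : (0 : ℝ) < p ^ 3 := pow_pos hp₀ 3
  have hp' : (p : ℝ) ^ 3 ≤ 1 := pow_le_one₀ p.2.1 p.2.2
  refine ⟨1 - p ^ 3 / 4, by linarith, by linarith, fun C => ?_⟩
  obtain ⟨c, hc, fast_le⟩ :=
    HypergraphTriangles.exists_eventually_measureReal_succeeds_rounds_le s hp₀ hp₁ C
      (show (0 : ℝ) < p ^ 3 / 8 by positivity)
  refine ⟨c * (p ^ 3 / 8), by positivity, ?_⟩
  filter_upwards [fast_le] with n fast_le B hB Ω _ P _ A M K hA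
  rw [show ((s + 2 : ℕ) : ℝ) - 5 / 3 = s + 1 / 3 by push_cast; ring]
  set x := c * ((n : ℝ) ^ ((s : ℝ) + 1 / 3) / Real.log n) with hx
  have hx₀ : 0 ≤ x := by positivity
  refine (ENNReal.ofReal_le_ofReal ?_).trans <| A.ofReal_mul_sub_le_expectedRounds M
    (fun ω => fast_le B ⌊x⌋₊ hB (Nat.floor_le hx₀) Ω A M K ω) hA
  calc c * (p ^ 3 / 8) * ((n : ℝ) ^ ((s : ℝ) + 1 / 3) / Real.log n)
      = x * (1 - p ^ 3 / 4 - (1 - p ^ 3 / 2 + p ^ 3 / 8)) := by rw [hx]; ring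
    _ ≤ _ := by
        gcongr
        · linarith
        · exact (Nat.lt_floor_add_one x).le

theorem theorem3p2 (r : ℕ) (hr : 2 ≤ r) :
    ∃ p : ℝ, 0 < p ∧ p < 1 ∧
      ∀ C : ℝ, ∃ c : ℝ, 0 < c ∧
        ∀ᶠ n : ℕ in atTop, ∀ B : ℕ, (B : ℝ) ≤ C * Real.log n →
          ∀ (Ω : Type*) [MeasurableSpace Ω] (P : Measure Ω) [IsProbabilityMeasure P]
            (A : HypergraphTriangles.Algorithm n B Ω) (M : HypergraphTriangles.Model)
            (K : HypergraphTriangles.TriangleKind),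
            ENNReal.ofReal p ≤ A.successProbability M K
                (HypergraphTriangles.randomHypergraph n r HypergraphTriangles.half) P →
            ENNReal.ofReal (c * ((n : ℝ) ^ ((r : ℝ) - 5 / 3) / Real.log n)) ≤
              A.expectedRounds M
                (HypergraphTriangles.randomHypergraph n r HypergraphTriangles.half) P :=
  theorem3p2_general r hr HypergraphTriangles.half (show (0 : ℝ) < 1 / 2 by norm_num)
    (show (1 / 2 : ℝ) < 1 by norm_num)
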